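/- Let $\Gamma$ be a group with a fixed finite symmetric generating set $S$, and let $\|\gamma\|_S$ be the word length of $\gamma\in\Gamma$. Let $n\ge 1$ and let $X$ be a contractible topological $n$-manifold (Hausdorff, second countable, without boundary) on which $\Gamma$ acts by homeomorphisms. The Hurder compactification $\tilde X$ of $X$ is the compactification defined by the algebra of all bounded continuous functions $f:X\to\mathbb R$ such that, for every $R>0$, $\max\{|f(x)-f(\gamma x)| : \|\gamma\|_S\le R\}\to 0$ as $x\to\infty$ in $X$; the Hurder corona is $\partial_\Gamma X=\tilde X\setminus X$. All cohomology has rational coefficients; let $\delta:\check H^{n-1}(\partial_\Gamma X)\to H^n_c(X)$ be the coboundary homomorphism of the pair $(\tilde X,\partial_\Gamma X)$, where $\check H^n(\tilde X,\partial_\Gamma X)=H^n_c(X)$. Let $\phi:\partial_\Gamma X\to S^{n-1}$ be a continuous map with $\delta([\phi])\ne 0$, where $[\phi]=\phi^*(u)$ for a generator $u$ of $H^{n-1}(S^{n-1};\mathbb Q)$ (for $n=1$: of the reduced group); that is, $\delta\circ\phi^*\ne 0$ on $H^{n-1}(S^{n-1};\mathbb Q)$. Then there is a map $p:X\to\mathbb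 R^n$ such that 1. $p$ is essential, i.e. $p$ is continuous and proper and $p^*:H^n_c(\mathbb R^n;\mathbb Q)\to H^n_c(X;\mathbb Q)$ is not zero; 2. $p$ satisfies the Displacement Bound Condition $\|p(x)-p(\gamma x)\|\le\|\gamma\|_S$ for all $x\in X$ and $\gamma\in\Gamma$; 3. there are an open neighbourhood $W$ of $\partial_\Gamma X$ in $\tilde X$ and a continuous extension $\bar\phi:W\to S^{n-1}$ of $\phi$ such that $p(x)=\|p(x)\|\,\bar\phi(x)$ for $x\in X\cap W$ and $p(x)=0$ for $x\in X\setminus W$. -/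

import Mathlib

open Topology Filter Set

noncomputable section

/-! ## Alexander-Spanier cohomology with rational coefficients

On paracompact Hausdorff spaces, in particular on compact Hausdorff spaces, this is the Čech
cohomology with rational coefficients, naturally in the space. -/

namespace AlexanderSpanier

/-- Rational functions of `k` points of `Y`.  Alexander-Spanier cochains of degree `q` are
represented by functions of `q + 1` points. -/
abbrev Cochain (k : ℕ) (Y : Type*) : Type _ := (Fin k → Y) → ℚ

variable {Y Z A : Type*}

/-- The Alexander-Spanier differential
`(d c) (y₀, …, yₖ) = ∑ i, (-1)ⁱ c (y₀, …, ŷᵢ, …, yₖ)`. -/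
def d {k : ℕ} : Cochain k Y →ₗ[ℚ] Cochain (k + 1) Y where
  toFun c := fun t => ∑ i : Fin (k + 1), (-1) ^ (i : ℕ) * c (t ∘ i.succAbove)
  map_add' a b := by
    funext t
    simp [mul_add, Finset.sum_add_distrib]
  map_smul' r a := by
    funext t
    simp only [Pi.smul_apply, smul_eq_mul, RingHom.id_apply, Finset.mul_sum]
    exact Finset.sum_congr rfl fun i _ => by ring

/-- Pull-back of cochains along an arbitrary function. -/
def pull {k : ℕ} (f : Y → Z) : Cochain k Z →ₗ[ℚ] Cochain k Y where
  toFun c := fun t => c (f ∘ t)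
  map_add' _ _ := rfl
  map_smul' _ _ := rfl

lemma pull_d {k : ℕ} (f : Y → Z) (c : Cochain k Z) : pull f (d c) = d (pull f c) := rfl

/-- Insertion of a point in the first argument. -/
def ins {k : ℕ} (y : Y) : Cochain (k + 1) Y →ₗ[ℚ] Cochain k Y where
  toFun c := fun t => c (Fin.cons y t)
  map_add' _ _ := rfl
  map_smul' _ _ := rfl

lemma ins_ext {k : ℕ} {a b : Cochain (k + 1) Y} (h : ∀ y, ins y a = ins y b) : a = b := by
  funext t
  have := congrFun (h (t 0)) (Fin.tail t)
  simpa [ins, Fin.cons_self_tail] using this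

lemma cons_comp_succ_succAbove {k : ℕ} (y : Y) (t : Fin (k + 1) → Y) (i : Fin (k + 1)) :
    (Fin.cons y t : Fin (k + 2) → Y) ∘ i.succ.succAbove
      = (Fin.cons y (t ∘ i.succAbove) : Fin (k + 1) → Y) := by
  funext j
  refine Fin.cases ?_ (fun j => ?_) j <;> simp

lemma ins_d {k : ℕ} (y : Y) (c : Cochain (k + 1) Y) : ins y (d c) = c - d (ins y c) := by
  funext t
  simp only [ins, d, LinearMap.coe_mk, AddHom.coe_mk, Pi.sub_apply]
  rw [Fin.sum_univ_succ]
  have h0 : (Fin.cons y t : Fin (k + 2) → Y) ∘ (0 : Fin (k + 2)).succAbove = t := by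
    funext j
    simp
  simp only [cons_comp_succ_succAbove, h0, Fin.val_zero, pow_zero, one_mul, Fin.val_succ,
    pow_succ, mul_neg, mul_one, neg_mul, Finset.sum_neg_distrib, sub_eq_add_neg]

lemma ins_d_zero (y : Y) (c : Cochain 0 Y) : ins y (d c) = c := by
  funext t
  simp only [ins, d, LinearMap.coe_mk, AddHom.coe_mk]
  simp [Subsingleton.elim _ t]

lemma d_d {k : ℕ} (c : Cochain k Y) : d (d c) = 0 := by
  induction k with
  | zero =>
    refine ins_ext fun y => ?_
    rw [ins_d, ins_d_zero]
    simp
  | succ k ih =>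
    refine ins_ext fun y => ?_
    rw [ins_d, ins_d, map_sub, ih]
    simp

open Classical in
/-- Extension of a cochain on `A` by zero to the tuples that are not contained in `A`. -/
def extend {k : ℕ} (A : Set Y) : Cochain k A →ₗ[ℚ] Cochain k Y where
  toFun c := fun t => if h : ∀ i, t i ∈ A then c fun i => ⟨t i, h i⟩ else 0
  map_add' a b := by
    funext t
    by_cases h : ∀ i, t i ∈ A <;> simp [h]
  map_smul' r a := by
    funext t
    by_cases h : ∀ i, t i ∈ A <;> simp [h]

lemma pull_extend {k : ℕ} (A : Set Y) (c : Cochain k A) :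
    pull Subtype.val (extend A c) = c := by
  funext t
  simp [pull, extend]

/-- The prism operator of two functions. -/
def prism (f g : Y → Z) : (k : ℕ) → Cochain (k + 1) Z → Cochain k Y
  | 0, _ => 0
  | k + 1, c => fun t =>
      c (Fin.cons (f (t 0)) (Fin.cons (g (t 0)) (g ∘ Fin.tail t)))
        - prism f g k (ins (f (t 0)) c) (Fin.tail t)

lemma ins_prism (f g : Y → Z) (k : ℕ) (c : Cochain (k + 2) Z) (y : Y) :
    ins y (prism f g (k + 1) c)
      = pull g (ins (g y) (ins (f y) c)) - prism f g k (ins (f y) c) := by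
  funext t
  simp [ins, prism, pull]

lemma ins_pull (f : Y → Z) (k : ℕ) (c : Cochain (k + 1) Z) (y : Y) :
    ins y (pull f c) = pull f (ins (f y) c) := by
  funext t
  simp only [ins, pull, LinearMap.coe_mk, AddHom.coe_mk]
  congr 1
  funext j
  refine Fin.cases ?_ (fun j => ?_) j <;> simp

lemma prism_sub (f g : Y → Z) (k : ℕ) (a b : Cochain (k + 1) Z) :
    prism f g k (a - b) = prism f g k a - prism f g k b := by
  induction k with
  | zero => simp [prism]
  | succ k ih =>
    refine ins_ext fun y => ?_
    rw [map_sub, ins_prism, ins_prism, ins_prism, map_sub, map_sub, map_sub, ih]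
    abel

lemma d_prism (f g : Y → Z) (k : ℕ) (c : Cochain (k + 1) Z) :
    d (prism f g k c) + prism f g (k + 1) (d c) = pull g c - pull f c := by
  induction k with
  | zero =>
    refine ins_ext fun y => ?_
    rw [map_add, ins_prism, map_sub, ins_pull, ins_pull, ins_d, map_sub, ins_d_zero]
    have h : pull f (ins (f y) c) = pull g (ins (f y) c) := by
      funext t
      exact congrArg (ins (f y) c) (Subsingleton.elim _ _)
    have h0 : pull g (ins (g y) (d (ins (f y) c))) = pull g (ins (f y) c) :=
      congrArg (pull g) (ins_d_zero (g y) (ins (f y) c))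
    simp [prism, h, h0]
  | succ k ih =>
    refine ins_ext fun y => ?_
    have h := ih (ins (f y) c)
    rw [map_add, map_sub, ins_d, ins_prism, ins_prism, map_sub, ins_pull, ins_pull, ins_d,
      map_sub, ins_d, prism_sub, map_sub, map_sub, ← pull_d]
    rw [← sub_eq_zero] at h ⊢
    rw [← h]
    abel

lemma prism_eq_zero (f g : Y → Z) {k : ℕ} {c : Cochain (k + 1) Z} {U : Set Z} {V : Set Y}
    (hc : ∀ t : Fin (k + 1) → Z, (∀ i, t i ∈ U) → c t = 0)
    (hf : ∀ y ∈ V, f y ∈ U) (hg : ∀ y ∈ V, g y ∈ U) (t : Fin k → Y) (ht : ∀ i, t i ∈ V) :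
    prism f g k c t = 0 := by
  induction k with
  | zero => rfl
  | succ k ih =>
    have h1 : c (Fin.cons (f (t 0)) (Fin.cons (g (t 0)) (g ∘ Fin.tail t))) = 0 := by
      refine hc _ fun i => ?_
      refine Fin.cases ?_ (fun i => ?_) i
      · simpa using hf _ (ht 0)
      · refine Fin.cases ?_ (fun i => ?_) i
        · simpa using hg _ (ht 0)
        · simpa [Fin.tail] using hg _ (ht i.succ)
    have h2 : prism f g k (ins (f (t 0)) c) (Fin.tail t) = 0 := by
      refine ih (fun s hs => hc _ fun i => ?_) _ fun i => ht i.succ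
      refine Fin.cases ?_ (fun i => ?_) i
      · simpa using hf _ (ht 0)
      · simpa using hs i
    simp [prism, h1, h2]

section Topological

variable [TopologicalSpace Y] [TopologicalSpace Z] [TopologicalSpace A]

/-- `c` vanishes on all tuples of points sufficiently close to `y`. -/
def LocZeroAt {k : ℕ} (c : Cochain k Y) (y : Y) : Prop :=
  ∃ U ∈ 𝓝 y, ∀ t : Fin k → Y, (∀ i, t i ∈ U) → c t = 0

lemma LocZeroAt.zero {k : ℕ} (y : Y) : LocZeroAt (0 : Cochain k Y) y :=
  ⟨univ, univ_mem, fun _ _ => rfl⟩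

lemma LocZeroAt.add {k : ℕ} {a b : Cochain k Y} {y : Y} (ha : LocZeroAt a y)
    (hb : LocZeroAt b y) : LocZeroAt (a + b) y := by
  obtain ⟨U, hU, hU'⟩ := ha
  obtain ⟨V, hV, hV'⟩ := hb
  refine ⟨U ∩ V, inter_mem hU hV, fun t ht => ?_⟩
  simp [hU' t fun i => (ht i).1, hV' t fun i => (ht i).2]

lemma LocZeroAt.smul {k : ℕ} {a : Cochain k Y} {y : Y} (r : ℚ) (ha : LocZeroAt a y) :
    LocZeroAt (r • a) y := by
  obtain ⟨U, hU, hU'⟩ := ha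
  exact ⟨U, hU, fun t ht => by simp [hU' t ht]⟩

lemma LocZeroAt.d {k : ℕ} {a : Cochain k Y} {y : Y} (ha : LocZeroAt a y) :
    LocZeroAt (AlexanderSpanier.d (k := k) a) y := by
  obtain ⟨U, hU, hU'⟩ := ha
  refine ⟨U, hU, fun t ht => ?_⟩
  change ∑ i : Fin (k + 1), (-1 : ℚ) ^ (i : ℕ) * a (t ∘ i.succAbove) = 0
  refine Finset.sum_eq_zero fun i _ => ?_
  rw [hU' (t ∘ i.succAbove) fun j => ht (i.succAbove j), mul_zero]

lemma LocZeroAt.pull {k : ℕ} {a : Cochain k Z} {f : Y → Z} {y : Y} (hf : ContinuousAt f y)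
    (ha : LocZeroAt a (f y)) : LocZeroAt (AlexanderSpanier.pull (k := k) f a) y := by
  obtain ⟨U, hU, hU'⟩ := ha
  exact ⟨f ⁻¹' U, hf hU, fun t ht => hU' _ ht⟩

lemma isOpen_locZeroAt {k : ℕ} (a : Cochain k Y) : IsOpen {y | LocZeroAt a y} := by
  rw [isOpen_iff_mem_nhds]
  rintro y ⟨U, hU, hU'⟩
  filter_upwards [eventually_mem_nhds_iff.2 hU] with z hz
  exact ⟨U, hz, hU'⟩

/-- The locally zero functions of `k` points. -/
def locZero (k : ℕ) (Y : Type*) [TopologicalSpace Y] : Submodule ℚ (Cochain k Y) where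
  carrier := {c | ∀ y, LocZeroAt c y}
  zero_mem' := fun y => LocZeroAt.zero y
  add_mem' := fun ha hb y => (ha y).add (hb y)
  smul_mem' := fun r _ ha y => (ha y).smul r

/-- A subcomplex of the complex of all functions that contains the locally zero functions, i.e.
a subcomplex of the Alexander-Spanier complex (functions modulo locally zero functions). -/
structure Subcomplex (Y : Type*) [TopologicalSpace Y] where
  carrier : ∀ k, Submodule ℚ (Cochain k Y)
  d_mem : ∀ {k : ℕ} {c : Cochain k Y}, c ∈ carrier k → d c ∈ carrier (k + 1)
  locZero_le : ∀ k, locZero k Y ≤ carrier k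

/-- All cochains: this computes the (absolute) cohomology of `Y`. -/
def allCochains (Y : Type*) [TopologicalSpace Y] : Subcomplex Y where
  carrier _ := ⊤
  d_mem _ := Submodule.mem_top
  locZero_le _ := le_top

/-- The cochains whose restriction to `A` is locally zero on `A`: this computes the relative
cohomology of `(Y, A)`. -/
def relCochains (A : Set Y) : Subcomplex Y where
  carrier k := (locZero k A).comap (pull Subtype.val)
  d_mem := fun hc a => (hc a).d
  locZero_le _ := fun _ hc a => (hc a).pull continuous_subtype_val.continuousAt

/-- The cochains which are locally zero, as cochains on `Y`, at every point of `A`, i.e. the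
cochains supported away from `A`. -/
def nearCochains (A : Set Y) : Subcomplex Y where
  carrier _ :=
    { carrier := {c | ∀ a ∈ A, LocZeroAt c a}
      zero_mem' := fun a _ => LocZeroAt.zero a
      add_mem' := fun ha hb y hy => (ha y hy).add (hb y hy)
      smul_mem' := fun r _ ha y hy => (ha y hy).smul r }
  d_mem := fun hc a ha => (hc a ha).d
  locZero_le _ := fun _ hc a _ => hc a

/-- The cochains with compact support: this computes the cohomology with compact supports. -/
def cptCochains (Y : Type*) [TopologicalSpace Y] : Subcomplex Y where
  carrier k :=
    { carrier := {c | ∃ K : Set Y, IsCompact K ∧ ∀ y ∉ K, LocZeroAt c y}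
      zero_mem' := ⟨∅, isCompact_empty, fun y _ => LocZeroAt.zero y⟩
      add_mem' := by
        rintro a b ⟨K, hK, ha⟩ ⟨L, hL, hb⟩
        exact ⟨K ∪ L, hK.union hL, fun y hy =>
          (ha y fun h => hy (Or.inl h)).add (hb y fun h => hy (Or.inr h))⟩
      smul_mem' := by
        rintro r a ⟨K, hK, ha⟩
        exact ⟨K, hK, fun y hy => (ha y hy).smul r⟩ }
  d_mem := by
    rintro k c ⟨K, hK, hc⟩
    exact ⟨K, hK, fun y hy => (hc y hy).d⟩
  locZero_le _ := fun _ hc => ⟨∅, isCompact_empty, fun y _ => hc y⟩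

/-- The functions of `q + 1` points that represent `q`-cocycles of the subcomplex: the
differential has to vanish modulo locally zero functions. -/
def cocycles (S : Subcomplex Y) (q : ℕ) : Submodule ℚ (Cochain (q + 1) Y) :=
  S.carrier (q + 1) ⊓ (locZero (q + 2) Y).comap d

/-- The functions of `q + 1` points that represent `q`-coboundaries of the subcomplex. -/
def coboundaries (S : Subcomplex Y) : (q : ℕ) → Submodule ℚ (Cochain (q + 1) Y)
  | 0 => locZero 1 Y
  | q + 1 => locZero (q + 2) Y ⊔ (S.carrier (q + 1)).map d

/-- The `q`-th cohomology group of a subcomplex of the Alexander-Spanier complex. -/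
abbrev H (S : Subcomplex Y) (q : ℕ) : Type _ :=
  cocycles S q ⧸ (coboundaries S q).submoduleOf (cocycles S q)

lemma mk_eq_zero_iff {S : Subcomplex Y} {q : ℕ} {c : Cochain (q + 1) Y} (hc : c ∈ cocycles S q) :
    (Submodule.Quotient.mk ⟨c, hc⟩ : H S q) = 0 ↔ c ∈ coboundaries S q :=
  Submodule.Quotient.mk_eq_zero _

/-- The map in cohomology induced by the pull-back along `f`, which has to map one subcomplex to
the other. -/
def mapH {S : Subcomplex Z} {T : Subcomplex Y} (f : Y → Z) (hf : Continuous f)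
    (h : ∀ (k : ℕ) (c : Cochain k Z), c ∈ S.carrier k → pull f c ∈ T.carrier k) (q : ℕ) :
    H S q →ₗ[ℚ] H T q :=
  Submodule.mapQ _ _
    ((pull f).restrict (p := cocycles S q) (q := cocycles T q) fun c hc =>
      ⟨h _ c hc.1, fun y => (hc.2 (f y)).pull hf.continuousAt⟩)
    (by
      rintro ⟨c, hc⟩ hcb
      change pull f c ∈ coboundaries T q
      change c ∈ coboundaries S q at hcb
      cases q with
      | zero => exact fun y => (hcb (f y)).pull hf.continuousAt
      | succ q =>
        obtain ⟨z, hz, w, ⟨e, he, rfl⟩, rfl⟩ := Submodule.mem_sup.1 hcb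
        exact Submodule.mem_sup.2 ⟨pull f z, fun y => (hz (f y)).pull hf.continuousAt,
          d (pull f e), ⟨pull f e, h _ e he, rfl⟩,
          (map_add (pull f) z (d e)).symm⟩)

/-- The cohomology of `Y`. -/
abbrev Cohomology (Y : Type*) [TopologicalSpace Y] (q : ℕ) : Type _ := H (allCochains Y) q

/-- The relative cohomology of the pair `(Y, A)`. -/
abbrev RelCohomology (A : Set Y) (q : ℕ) : Type _ := H (relCochains A) q

/-- The cohomology of `Y` with compact supports. -/
abbrev CptCohomology (Y : Type*) [TopologicalSpace Y] (q : ℕ) : Type _ := H (cptCochains Y) q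

/-- The homomorphism `f^*` induced by a continuous map. -/
def pullback (f : C(Y, Z)) (q : ℕ) : Cohomology Z q →ₗ[ℚ] Cohomology Y q :=
  mapH f f.continuous (fun _ _ _ => Submodule.mem_top) q

/-- The homomorphism `f^*` of cohomology with compact supports induced by a proper map. -/
def cptPullback (f : Y → Z) (hf : IsProperMap f) (q : ℕ) :
    CptCohomology Z q →ₗ[ℚ] CptCohomology Y q :=
  mapH f hf.continuous (by
    rintro k c ⟨K, hK, hc⟩
    exact ⟨f ⁻¹' K, hf.isCompact_preimage hK,
      fun y hy => (hc (f y) hy).pull hf.continuous.continuousAt⟩) q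

/-! ### The coboundary homomorphism of a pair -/

/-- The coboundary homomorphism of the pair `(Y, A)`: extend a cocycle of `A` to a cochain of `Y`
and take its differential. -/
def relDelta (A : Set Y) (q : ℕ) : Cohomology A q →ₗ[ℚ] RelCohomology A (q + 1) :=
  Submodule.mapQ _ _
    ((d ∘ₗ extend A).restrict (p := cocycles (allCochains A) q)
      (q := cocycles (relCochains A) (q + 1)) fun c hc => by
        refine ⟨?_, ?_⟩
        · change pull Subtype.val (d (extend A c)) ∈ locZero (q + 2) A
          rw [pull_d, pull_extend]
          exact hc.2
        · change d (d (extend A c)) ∈ locZero (q + 3) Y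
          rw [d_d]
          exact zero_mem _)
    (by
      rintro ⟨c, hc⟩ hcb
      change d (extend A c) ∈ locZero (q + 2) Y ⊔ ((relCochains A).carrier (q + 1)).map d
      refine Submodule.mem_sup_right ?_
      change c ∈ coboundaries (allCochains A) q at hcb
      cases q with
      | zero =>
        refine ⟨extend A c, ?_, rfl⟩
        change pull Subtype.val (extend A c) ∈ locZero 1 A
        rw [pull_extend]
        exact hcb
      | succ q =>
        obtain ⟨z, hz, w, ⟨e, he, rfl⟩, rfl⟩ := Submodule.mem_sup.1 hcb
        refine ⟨extend A (z + d e) - d (extend A e), ?_, ?_⟩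
        · change pull Subtype.val (extend A (z + d e) - d (extend A e)) ∈ locZero (q + 2) A
          rw [map_sub, pull_d, pull_extend, pull_extend, add_sub_cancel_right]
          exact hz
        · rw [map_sub, d_d, sub_zero])

/-! ### Relative cochains and cochains supported away from a closed subset -/

/-- A relative cochain of a compact pair whose differential is supported away from `A` is, up to
the differential of a relative cochain, itself supported away from `A`. -/
lemma exists_sub_d_mem_near [CompactSpace Y] [T2Space Y] {A : Set Y} (hA : IsClosed A) {k : ℕ}
    {c : Cochain (k + 1) Y} (hc : c ∈ (relCochains A).carrier (k + 1))
    (hdc : d c ∈ (nearCochains A).carrier (k + 2)) :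
    ∃ h : Cochain k Y, h ∈ (relCochains A).carrier k ∧ (k = 0 → h = 0) ∧
      c - d h ∈ (nearCochains A).carrier (k + 1) := by
  classical
  let _ : UniformSpace Y := uniformSpaceOfCompactR1
  have key : ∀ a : A, ∃ U : Set Y, IsOpen U ∧ (a : Y) ∈ U ∧
      (∀ t : Fin (k + 1) → Y, (∀ i, t i ∈ U ∩ A) → c t = 0) ∧
      (∀ t : Fin (k + 2) → Y, (∀ i, t i ∈ U) → d c t = 0) := by
    intro a
    obtain ⟨U, hU, hU'⟩ := hc a
    obtain ⟨V, hV, hV'⟩ := hdc a a.2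
    rw [nhds_subtype, mem_comap] at hU
    obtain ⟨W, hW, hWU⟩ := hU
    obtain ⟨O, hO, hOo, haO⟩ := mem_nhds_iff.1 (inter_mem hW hV)
    refine ⟨O, hOo, haO, fun t ht => ?_, fun t ht => hV' t fun i => (hO (ht i)).2⟩
    exact hU' (fun i => ⟨t i, (ht i).2⟩) fun i => hWU (hO (ht i).1).1
  choose U hUo haU hU hdU using key
  obtain ⟨V, hV, hVU⟩ := lebesgue_number_lemma hA.isCompact hUo
    (fun a ha => mem_iUnion.2 ⟨⟨a, ha⟩, haU _⟩)
  obtain ⟨W, hW, hWV⟩ := comp_mem_uniformity_sets hV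
  let r : Y → Y := fun y =>
    if y ∈ A then y else if h : ∃ a ∈ A, (y, a) ∈ W then h.choose else y
  have hrA : ∀ y ∈ A, r y = y := fun y hy => by simp [r, hy]
  have hr : ∀ y, (∃ a ∈ A, (y, a) ∈ W) → r y ∈ A ∧ (y, r y) ∈ W := by
    intro y hy
    by_cases hyA : y ∈ A
    · rw [hrA y hyA]
      exact ⟨hyA, refl_mem_uniformity hW⟩
    · have : r y = hy.choose := by simp only [r, hyA, if_false, dif_pos hy]
      rw [this]
      exact hy.choose_spec
  have hprA : ∀ a ∈ A, ∃ N ∈ 𝓝 a, ∃ b, N ⊆ U b ∧ ∀ y ∈ N, r y ∈ U b ∩ A := by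
    intro a ha
    obtain ⟨b, hb⟩ := hVU a ha
    refine ⟨{y | (a, y) ∈ W} ∩ {y | (y, a) ∈ W},
      inter_mem (mem_nhds_left a hW) (mem_nhds_right a hW), b, fun y hy => ?_, fun y hy => ?_⟩
    · exact hb (hWV ⟨a, refl_mem_uniformity hW, hy.1⟩)
    · obtain ⟨h1, h2⟩ := hr y ⟨a, ha, hy.2⟩
      exact ⟨hb (hWV ⟨y, hy.1, h2⟩), h1⟩
  refine ⟨prism r id k c, ?_, ?_, ?_⟩
  · intro a
    obtain ⟨N, hN, b, hNb, -⟩ := hprA a a.2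
    refine ⟨Subtype.val ⁻¹' N, continuous_subtype_val.continuousAt hN, fun t ht => ?_⟩
    refine prism_eq_zero r id (U := U b ∩ A) (V := N ∩ A) (hU b) ?_ ?_ _
      (fun i => ⟨ht i, (t i).2⟩)
    · intro y hy
      rw [hrA y hy.2]
      exact ⟨hNb hy.1, hy.2⟩
    · intro y hy
      exact ⟨hNb hy.1, hy.2⟩
  · rintro rfl
    rfl
  · intro a ha
    obtain ⟨N, hN, b, hNb, hrN⟩ := hprA a ha
    have h := d_prism r id k c
    have h' : c - d (prism r id k c) = pull r c + prism r id (k + 1) (d c) := by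
      have hid : pull id c = c := rfl
      rw [hid] at h
      rw [sub_eq_iff_eq_add, add_assoc, add_comm (prism r id (k + 1) (d c)), h]
      abel
    rw [h']
    refine LocZeroAt.add ⟨N, hN, fun t ht => hU b _ fun i => hrN _ (ht i)⟩
      ⟨N, hN, fun t ht => prism_eq_zero r id (hdU b) (fun y hy => (hrN y hy).1)
        (fun y hy => hNb hy) t ht⟩

/-- The homomorphism from the cohomology supported away from `A` to the relative cohomology that
is induced by the inclusion of cochains. -/
def nearToRel (A : Set Y) (q : ℕ) : H (nearCochains A) q →ₗ[ℚ] RelCohomology A q :=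
  mapH (S := nearCochains A) (T := relCochains A) id continuous_id
    (fun _ c hc a => LocZeroAt.pull (a := c) (f := Subtype.val)
      continuous_subtype_val.continuousAt (hc a a.2)) q

/-- For a compact pair this homomorphism is an isomorphism. -/
lemma nearToRel_bijective [CompactSpace Y] [T2Space Y] {A : Set Y} (hA : IsClosed A) (q : ℕ) :
    Function.Bijective (nearToRel A q) := by
  constructor
  · rw [injective_iff_map_eq_zero]
    intro x hx
    obtain ⟨⟨c, hc⟩, rfl⟩ := Submodule.Quotient.mk_surjective _ x
    have hx' : c ∈ coboundaries (relCochains A) q := (mk_eq_zero_iff _).1 hx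
    refine (mk_eq_zero_iff _).2 ?_
    cases q with
    | zero => exact hx'
    | succ q =>
      obtain ⟨z, hz, w, ⟨e, he, rfl⟩, rfl⟩ := Submodule.mem_sup.1 hx'
      have hde : d e ∈ (nearCochains A).carrier (q + 2) := by
        have := sub_mem hc.1 ((nearCochains A).locZero_le _ hz)
        rwa [add_sub_cancel_left] at this
      obtain ⟨h, -, -, hh⟩ := exists_sub_d_mem_near hA he hde
      refine Submodule.mem_sup.2 ⟨z, hz, d e, ⟨e - d h, hh, ?_⟩, rfl⟩
      rw [map_sub, d_d, sub_zero]
  · intro x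
    obtain ⟨⟨c, hc⟩, rfl⟩ := Submodule.Quotient.mk_surjective _ x
    obtain ⟨h, hh, h0, hch⟩ := exists_sub_d_mem_near hA hc.1 fun a _ => hc.2 a
    have hcoc : c - d h ∈ cocycles (nearCochains A) q := by
      refine ⟨hch, ?_⟩
      change d (c - d h) ∈ locZero (q + 2) Y
      rw [map_sub, d_d, sub_zero]
      exact hc.2
    refine ⟨Submodule.Quotient.mk ⟨c - d h, hcoc⟩, ?_⟩
    refine sub_eq_zero.1 ((mk_eq_zero_iff (S := relCochains A) (c := c - d h - c)
      (sub_mem ⟨(relCochains A).d_mem hh |> sub_mem hc.1, hcoc.2⟩ hc)).2 ?_)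
    rw [sub_sub_cancel_left]
    refine neg_mem ?_
    cases q with
    | zero =>
      rw [h0 rfl, map_zero]
      exact zero_mem _
    | succ q => exact Submodule.mem_sup_right ⟨h, hh, rfl⟩

/-- Restriction of cochains supported away from the complement of an open subspace `X` of a
compact space to cochains of `X` with compact support. -/
def nearToCpt [CompactSpace Y] {e : A → Y} (he : IsOpenEmbedding e) (q : ℕ) :
    H (nearCochains (range e)ᶜ) q →ₗ[ℚ] CptCohomology A q :=
  mapH e he.continuous (by
    intro k c hc
    refine ⟨e ⁻¹' {y | LocZeroAt c y}ᶜ, ?_, fun y hy => ?_⟩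
    · refine he.isInducing.isCompact_preimage' (isOpen_locZeroAt c).isClosed_compl.isCompact ?_
      intro y hy
      by_contra h
      exact hy (hc y h)
    · exact LocZeroAt.pull he.continuous.continuousAt (not_not.1 hy)) q

/-- The coboundary homomorphism `H^q(Y ∖ X) → H_c^(q+1)(X)` of a compactification `Y` of `X` (more
generally, of an open subspace `X` of a compact Hausdorff space `Y`): the coboundary homomorphism
of the pair `(Y, Y ∖ X)` followed by the isomorphism of `H^(q+1)(Y, Y ∖ X)` with
`H_c^(q+1)(X)`. -/
def coronaDelta [CompactSpace Y] [T2Space Y] {e : A → Y} (he : IsOpenEmbedding e) (q : ℕ) :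
    Cohomology ((range e)ᶜ : Set Y) q →ₗ[ℚ] CptCohomology A (q + 1) :=
  nearToCpt he (q + 1) ∘ₗ
    (LinearEquiv.ofBijective _
      (nearToRel_bijective he.isOpen_range.isClosed_compl (q + 1))).symm.toLinearMap ∘ₗ
    relDelta _ q

end Topological

end AlexanderSpanier

/-! ## The Hurder compactification -/

section Hurder

variable {Γ : Type*} [Group Γ]

/-- The length of `γ` with respect to the generating set `S`: the least length of a word in
elements of `S` that represents `γ`. -/
def wordLength (S : Finset Γ) (γ : Γ) : ℕ :=
  sInf {k | ∃ l : List Γ, (∀ s ∈ l, s ∈ S) ∧ l.prod = γ ∧ l.length = k}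

variable {X : Type*} [MulAction Γ X]

/-- The `Γ`-variation `max {|f x - f (γ x)| : ‖γ‖ ≤ R}` of `f` at `x` in the `R`-ball. -/
def gammaVar (S : Finset Γ) (R : ℕ) (f : X → ℝ) (x : X) : ℝ :=
  ⨆ γ : {γ : Γ // wordLength S γ ≤ R}, |f x - f (γ.1 • x)|

variable [TopologicalSpace X]

/-- The Hurder algebra: the bounded continuous functions whose `Γ`-variation in every ball tends
to zero at infinity. -/
def hurderAlgebra (S : Finset Γ) (X : Type*) [MulAction Γ X] [TopologicalSpace X] :
    Set (BoundedContinuousFunction X ℝ) :=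
  {f | ∀ R : ℕ, Tendsto (gammaVar S R f) (cocompact X) (𝓝 0)}

/-- The evaluation map of `X` into the product of lines indexed by the Hurder algebra. -/
def hurderEval (S : Finset Γ) (X : Type*) [MulAction Γ X] [TopologicalSpace X] (x : X) :
    hurderAlgebra S X → ℝ := fun f => f.1 x

/-- The Hurder compactification: the compactification of `X` defined by the Hurder algebra, i.e.
the closure of the image of `X` under the evaluation map. -/
abbrev HurderCompactification (S : Finset Γ) (X : Type*) [MulAction Γ X] [TopologicalSpace X] :
    Type _ := closure (range (hurderEval S X))

/-- The canonical map of `X` to its Hurder compactification. -/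
def toHurder (S : Finset Γ) (X : Type*) [MulAction Γ X] [TopologicalSpace X] (x : X) :
    HurderCompactification S X := ⟨hurderEval S X x, subset_closure (mem_range_self x)⟩

/-- The Hurder corona: the complement of `X` in the Hurder compactification. -/
abbrev HurderCorona (S : Finset Γ) (X : Type*) [MulAction Γ X] [TopologicalSpace X] :
    Set (HurderCompactification S X) := (range (toHurder S X))ᶜ

instance (S : Finset Γ) : CompactSpace (HurderCompactification S X) := by
  rw [← isCompact_iff_compactSpace]
  refine (isCompact_univ_pi (s := fun f : hurderAlgebra S X => Icc (-‖f.1‖) ‖f.1‖)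
    fun _ => isCompact_Icc).of_isClosed_subset isClosed_closure ?_
  refine closure_minimal ?_ (isClosed_set_pi fun _ _ => isClosed_Icc)
  rintro _ ⟨x, rfl⟩ f -
  exact abs_le.1 (f.1.norm_coe_le_norm x)

lemma continuous_toHurder (S : Finset Γ) : Continuous (toHurder S X) :=
  Continuous.subtype_mk (continuous_pi fun f => f.1.continuous) _

/-- `S` is a (finite) symmetric generating set of `Γ`. -/
structure IsSymmGenSet (S : Finset Γ) : Prop where
  inv_mem : ∀ s ∈ S, s⁻¹ ∈ S
  closure_eq_top : Subgroup.closure (S : Set Γ) = ⊤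

lemma IsSymmGenSet.exists_word {S : Finset Γ} (hS : IsSymmGenSet S) (γ : Γ) :
    ∃ l : List Γ, (∀ s ∈ l, s ∈ S) ∧ l.prod = γ ∧ l.length = wordLength S γ := by
  refine Nat.sInf_mem (s := {k | ∃ l : List Γ, (∀ s ∈ l, s ∈ S) ∧ l.prod = γ ∧ l.length = k}) ?_
  have hmem : γ ∈ (Subgroup.closure (S : Set Γ)).toSubmonoid := by
    rw [hS.closure_eq_top]
    trivial
  rw [Subgroup.closure_toSubmonoid] at hmem
  obtain ⟨l, hl, hγ⟩ := Submonoid.exists_list_of_mem_closure hmem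
  refine ⟨l.length, l, fun s hs => ?_, hγ, rfl⟩
  rcases hl s hs with h | h
  · exact h
  · simpa using hS.inv_mem _ h

lemma IsSymmGenSet.finite_ball {S : Finset Γ} (hS : IsSymmGenSet S) (R : ℕ) :
    {γ : Γ | wordLength S γ ≤ R}.Finite := by
  have h : Finite {l : List S // l.length ≤ R} := List.finite_length_le S R
  refine (Set.finite_range fun l : {l : List S // l.length ≤ R} =>
    (l.1.map Subtype.val).prod).subset fun γ hγ => ?_
  obtain ⟨l, hl, hp, hlen⟩ := hS.exists_word γ
  refine ⟨⟨l.attach.map fun s => ⟨s.1, hl _ s.2⟩, ?_⟩, ?_⟩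
  · simpa [hlen] using hγ
  · simpa using hp

lemma mem_hurderAlgebra_of_hasCompactSupport [ContinuousConstSMul Γ X] {S : Finset Γ}
    (hS : IsSymmGenSet S) (f : BoundedContinuousFunction X ℝ) (hf : HasCompactSupport f) :
    f ∈ hurderAlgebra S X := by
  intro R
  have hK : IsCompact (⋃ γ ∈ insert (1 : Γ) {γ : Γ | wordLength S γ ≤ R},
      (fun x : X => γ⁻¹ • x) '' tsupport f) :=
    ((hS.finite_ball R).insert 1).isCompact_biUnion fun γ _ => hf.image (continuous_const_smul _)
  refine tendsto_const_nhds.congr' ?_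
  filter_upwards [hK.compl_mem_cocompact] with x hx
  have h : ∀ γ ∈ insert (1 : Γ) {γ : Γ | wordLength S γ ≤ R}, f (γ • x) = 0 := by
    intro γ hγ
    by_contra h
    exact hx (mem_biUnion hγ ⟨γ • x, subset_tsupport f h, by simp⟩)
  have h1 : f x = 0 := by simpa using h 1 (mem_insert _ _)
  have h2 : ∀ γ : {γ : Γ // wordLength S γ ≤ R}, |f x - f (γ.1 • x)| = 0 := fun γ => by
    simp [h1, h _ (mem_insert_of_mem _ γ.2)]
  simp [gammaVar, h2]

lemma exists_hurder_bump [T2Space X] [LocallyCompactSpace X] [ContinuousConstSMul Γ X]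
    {S : Finset Γ} (hS : IsSymmGenSet S) (x : X) {U : Set X} (hU : U ∈ 𝓝 x) :
    ∃ f : hurderAlgebra S X, f.1 x = 1 ∧ HasCompactSupport f.1 ∧ ∀ y ∉ U, f.1 y = 0 := by
  obtain ⟨V, hVU, hV, hxV⟩ := mem_nhds_iff.1 hU
  obtain ⟨f, hf1, hf0, hfc, hf⟩ := exists_continuous_one_zero_of_isCompact
    (isCompact_singleton (x := x)) hV.isClosed_compl (by simpa using hxV)
  let g : BoundedContinuousFunction X ℝ := BoundedContinuousFunction.ofNormedAddCommGroup f
    f.continuous 1 fun y => by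
      rw [Real.norm_eq_abs, abs_le]
      exact ⟨by linarith [(hf y).1], (hf y).2⟩
  refine ⟨⟨g, mem_hurderAlgebra_of_hasCompactSupport hS g hfc⟩, hf1 rfl, hfc, fun y hy => ?_⟩
  exact hf0 fun h => hy (hVU h)

lemma isOpenEmbedding_toHurder [T2Space X] [LocallyCompactSpace X] [ContinuousConstSMul Γ X]
    {S : Finset Γ} (hS : IsSymmGenSet S) : IsOpenEmbedding (toHurder S X) := by
  have hc := continuous_toHurder (X := X) S
  refine ⟨⟨isInducing_iff_nhds.2 fun x => le_antisymm (hc.continuousAt.le_comap) ?_, ?_⟩, ?_⟩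
  · intro U hU
    obtain ⟨f, hf1, -, hf0⟩ := exists_hurder_bump hS x hU
    refine mem_comap.2 ⟨{z | (0 : ℝ) < z.1 f}, ?_, fun y hy => ?_⟩
    · refine IsOpen.mem_nhds (isOpen_lt continuous_const
        ((continuous_apply f).comp continuous_subtype_val)) ?_
      change (0 : ℝ) < f.1 x
      rw [hf1]
      exact one_pos
    · by_contra h
      exact lt_irrefl (0 : ℝ) ((show (0 : ℝ) < f.1 y from hy).trans_eq (hf0 y h))
  · intro x y hxy
    by_contra hne
    obtain ⟨f, hf1, -, hf0⟩ := exists_hurder_bump hS x (isOpen_compl_singleton.mem_nhds hne)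
    have h : f.1 x = f.1 y := congrFun (congrArg Subtype.val hxy) f
    rw [hf1, hf0 y (by simp)] at h
    exact one_ne_zero h
  · rw [isOpen_iff_mem_nhds]
    rintro _ ⟨x, rfl⟩
    obtain ⟨f, hf1, hfc, -⟩ := exists_hurder_bump hS x univ_mem
    have hO : IsOpen {z : HurderCompactification S X | (0 : ℝ) < z.1 f} :=
      isOpen_lt continuous_const ((continuous_apply f).comp continuous_subtype_val)
    have hx : (0 : ℝ) < (toHurder S X x).1 f := by
      change (0 : ℝ) < f.1 x
      rw [hf1]
      exact one_pos
    refine mem_of_superset (hO.mem_nhds hx) fun z hz => ?_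
    have hcl : IsClosed (toHurder S X '' tsupport f.1) := (hfc.image hc).isClosed
    have hmem : z ∈ closure (toHurder S X '' tsupport f.1) := by
      have hd : z ∈ closure (range (toHurder S X)) := by
        rw [closure_subtype]
        convert z.2 using 2
        ext w
        simp [toHurder]
      refine closure_mono ?_ (hO.inter_closure ⟨hz, hd⟩)
      rintro _ ⟨hy, y, rfl⟩
      exact ⟨y, subset_tsupport _ (ne_of_gt (show (0 : ℝ) < f.1 y from hy)), rfl⟩
    rw [hcl.closure_eq] at hmem
    exact image_subset_range _ _ hmem

/-- The coboundary homomorphism `H^q(∂_Γ X) → H_c^(q+1)(X)` of the Hurder compactification. -/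
def hurderDelta [T2Space X] [LocallyCompactSpace X] [ContinuousConstSMul Γ X] {S : Finset Γ}
    (hS : IsSymmGenSet S) (q : ℕ) :
    AlexanderSpanier.Cohomology (HurderCorona S X) q →ₗ[ℚ]
      AlexanderSpanier.CptCohomology X (q + 1) :=
  AlexanderSpanier.coronaDelta (isOpenEmbedding_toHurder hS) q

/-- A map `p` between locally compact spaces is essential in dimension `n` if it is proper and
induces a non-zero homomorphism of the `n`-dimensional rational cohomology with compact supports. -/
def IsEssential {X Y : Type*} [TopologicalSpace X] [TopologicalSpace Y] (n : ℕ) (p : X → Y) :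
    Prop :=
  ∃ hp : IsProperMap p, AlexanderSpanier.cptPullback p hp n ≠ 0

/-- The Displacement Bound Condition `‖p x - p (γ x)‖ ≤ ‖γ‖` for all `γ` and `x`. -/
def DisplacementBound {E : Type*} [NormedAddCommGroup E] (S : Finset Γ) (p : X → E) : Prop :=
  ∀ (γ : Γ) (x : X), ‖p x - p (γ • x)‖ ≤ wordLength S γ

/-- In polar coordinates, the angular coordinate of `p` is the restriction to `X` of a
continuous extension of `φ` to an open neighbourhood `W` of the corona in the Hurder
compactification, and `p` vanishes at the points of `X` outside of `W`. -/
def IsPolarExtension {E : Type*} [NormedAddCommGroup E] [NormedSpace ℝ E] (S : Finset Γ)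
    (φ : C(HurderCorona S X, Metric.sphere (0 : E) 1)) (p : X → E) : Prop :=
  ∃ (W : Set (HurderCompactification S X)) (ψ : C(W, Metric.sphere (0 : E) 1)),
    IsOpen W ∧ HurderCorona S X ⊆ W ∧
    (∀ (z : HurderCompactification S X) (hz : z ∈ HurderCorona S X) (hW : z ∈ W),
      ψ ⟨z, hW⟩ = φ ⟨z, hz⟩) ∧
    (∀ (x : X) (hW : toHurder S X x ∈ W), p x = ‖p x‖ • (ψ ⟨toHurder S X x, hW⟩ : E)) ∧
    ∀ x : X, toHurder S X x ∉ W → p x = 0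

end Hurder

end

/-!
The map `φ` to the sphere extends, by Tietze's theorem, to a continuous map from the Hurder
compactification to Euclidean space; after normalization this is a map `q` with values in the unit
ball that has norm `1` on a neighbourhood `W` of the corona.  The map `p` is `r • q` for a
suitable proper function `r ≥ 0` on `X` that vanishes outside of `W`, so that the angular
coordinate of `p` is `q`.

*Displacement.*  By the triangle inequality along a word, it is enough to bound the displacement
under a generator `s` by `1`.  The compactification is compact and its uniformity is induced by
the Hurder algebra, so the variation of `q` under `S` tends to zero at infinity
(`tendsto_sum_norm_sub_smul`).  On a `σ`-compact space there is an exhaustion by compact sets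
`K j`, each moved into the next one by `S`, outside of which this variation is as small as one
likes; a function `r` that is about `j / 4` on `K j ∖ K (j - 1)` is proper, changes by at most
`1 / 2` under a generator, and its product with the variation of `q` is at most `1 / 2`
(`exists_slow_proper`).

*Essentiality.*  Let the cocycle `c` represent a class of the sphere.  Pulled back to the
complement of the origin and extended by zero, it is a cochain of Euclidean space whose
differential is supported at the origin, i.e. a cocycle with compact support.  Its image under
`p^*` represents `δ (φ^* [c])` (`AlexanderSpanier.exists_cptPullback_eq_coronaDelta`): the latter is
represented by the differential of any extension of `φ^* c` that is a cocycle near the corona, in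
particular of the pull-back of `c` to `W`, and the two primitives agree outside of the compact set
`p ⁻¹' {0}`.  So `p^* ≠ 0` if `δ ∘ φ^* ≠ 0`; no cohomology group has to be computed.
-/

/-! ### The coboundary of the corona and radial extensions -/

namespace AlexanderSpanier

lemma d_extend_apply {Y : Type*} {k : ℕ} (A : Set Y) (c : Cochain k A) {t : Fin (k + 1) → Y}
    (ht : ∀ i, t i ∈ A) : d (extend A c) t = d c fun i => ⟨t i, ht i⟩ := by
  have h := congrFun (pull_d (Subtype.val : A → Y) (extend A c)) fun i => ⟨t i, ht i⟩
  rw [pull_extend] at h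
  exact h

lemma LocZeroAt.d_extend {Y : Type*} [TopologicalSpace Y] {k : ℕ} {A : Set Y} (hA : IsOpen A)
    {c : Cochain k A} {y : Y} (hy : y ∈ A)
    (hc : LocZeroAt (AlexanderSpanier.d c) (⟨y, hy⟩ : A)) :
    LocZeroAt (AlexanderSpanier.d (extend A c)) y := by
  obtain ⟨U, hU, hU'⟩ := hc
  refine ⟨Subtype.val '' U, hA.isOpenEmbedding_subtypeVal.isOpenMap.image_mem_nhds hU,
    fun t ht => ?_⟩
  have htA : ∀ i, t i ∈ A := fun i => by
    obtain ⟨a, -, ha⟩ := ht i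
    exact ha ▸ a.2
  rw [d_extend_apply A c htA]
  refine hU' _ fun i => ?_
  obtain ⟨a, haU, ha⟩ := ht i
  convert haU
  exact ha.symm

section Radial

variable {E : Type*} [NormedAddCommGroup E] [NormedSpace ℝ E]

/-- The radial projection of the complement of the origin to the unit sphere. -/
noncomputable def radial : C(({0}ᶜ : Set E), Metric.sphere (0 : E) 1) where
  toFun v := ⟨‖(v : E)‖⁻¹ • (v : E), by
    simp [norm_smul, inv_mul_cancel₀ (norm_ne_zero_iff.2 v.2)]⟩
  continuous_toFun := by
    refine Continuous.subtype_mk (Continuous.smul (Continuous.inv₀ (by fun_prop) fun v => ?_)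
      continuous_subtype_val) _
    exact norm_ne_zero_iff.2 v.2

/-- A cocycle of the sphere, pulled back to `E ∖ {0}` and extended by zero to `E`, has a
differential supported at the origin.  This represents the coboundary of the class of the sphere
in the compactification of `E` to a ball. -/
lemma d_extend_radial_mem {k : ℕ} {c : Cochain (k + 1) (Metric.sphere (0 : E) 1)}
    (hc : c ∈ cocycles (allCochains _) k) :
    d (extend {0}ᶜ (pull radial c)) ∈ cocycles (cptCochains E) (k + 1) := by
  refine ⟨⟨{0}, isCompact_singleton, fun y hy => ?_⟩, ?_⟩
  · exact LocZeroAt.d_extend isOpen_compl_singleton hy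
      (LocZeroAt.pull radial.continuous.continuousAt (hc.2 _))
  · change d (d _) ∈ locZero (k + 3) E
    rw [d_d]
    exact zero_mem _

variable {X Y : Type*} [TopologicalSpace X] [TopologicalSpace Y] [CompactSpace Y] [T2Space Y]

/-- The coboundary of a class of the corona can be computed from a continuation of a
representative to an open neighbourhood `W` of the corona. -/
lemma coronaDelta_pullback {Z : Type*} [TopologicalSpace Z] {e : X → Y} (he : IsOpenEmbedding e)
    (φ : C(((range e)ᶜ : Set Y), Z)) {W : Set Y} (hW : IsOpen W) (hsub : (range e)ᶜ ⊆ W)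
    (ψ : C(W, Z)) (hψ : ∀ (z : Y) (hz : z ∈ (range e)ᶜ) (hzW : z ∈ W),
      ψ ⟨z, hzW⟩ = φ ⟨z, hz⟩) {k : ℕ} {c : Cochain (k + 1) Z}
    (hc : c ∈ cocycles (allCochains Z) k) :
    ∃ h : pull e (d (extend W (pull ψ c))) ∈ cocycles (cptCochains X) (k + 1),
      coronaDelta he k (pullback φ k (Submodule.Quotient.mk ⟨c, hc⟩))
        = Submodule.Quotient.mk ⟨_, h⟩ := by
  have hnear : d (extend W (pull ψ c)) ∈ cocycles (nearCochains (range e)ᶜ) (k + 1) := by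
    refine ⟨fun a ha => ?_, ?_⟩
    · exact LocZeroAt.d_extend hW (hsub ha)
        (LocZeroAt.pull ψ.continuous.continuousAt (hc.2 _))
    · change d (d _) ∈ locZero (k + 3) Y
      rw [d_d]
      exact zero_mem _
  -- The differential of the continuation differs from that of the extension by zero by the
  -- differential of a cochain that vanishes on the corona.
  let y : H (nearCochains (range e)ᶜ) (k + 1) := Submodule.Quotient.mk ⟨_, hnear⟩
  have hrel : relDelta (range e)ᶜ k (pullback φ k (Submodule.Quotient.mk ⟨c, hc⟩))
      = nearToRel (range e)ᶜ (k + 1) y := by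
    refine (Submodule.Quotient.eq _).2 ?_
    change d (extend (range e)ᶜ (pull φ c)) - d (extend W (pull ψ c))
      ∈ coboundaries (relCochains (range e)ᶜ) (k + 1)
    rw [← map_sub]
    refine Submodule.mem_sup_right ⟨_, ?_, rfl⟩
    change pull Subtype.val (_ - _) ∈ locZero (k + 1) _
    have h0 : pull (Subtype.val : ((range e)ᶜ : Set Y) → Y) (extend W (pull ψ c))
        = pull φ c := by
      funext t
      have ht : ∀ i, (t i : Y) ∈ W := fun i => hsub (t i).2
      simp only [pull, extend, LinearMap.coe_mk, AddHom.coe_mk, Function.comp_apply, ht,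
        implies_true, dif_pos]
      congr 1
      funext i
      exact hψ _ (t i).2 _
    rw [map_sub, pull_extend, h0, sub_self]
    exact zero_mem _
  have hsymm : coronaDelta he k (pullback φ k (Submodule.Quotient.mk ⟨c, hc⟩))
      = nearToCpt he (k + 1) y := by
    change nearToCpt he (k + 1) ((LinearEquiv.ofBijective _
      (nearToRel_bijective he.isOpen_range.isClosed_compl (k + 1))).symm
        (relDelta _ k (pullback φ k (Submodule.Quotient.mk ⟨c, hc⟩)))) = _
    rw [hrel]
    congr 1
    exact LinearEquiv.ofBijective_symm_apply_apply _ _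
  rw [hsymm]
  exact ⟨_, rfl⟩

/-- If `p` is proper and its angular coordinate near the corona extends `φ`, then `δ ∘ φ^*` takes
values in the image of `p^*`. -/
lemma exists_cptPullback_eq_coronaDelta {e : X → Y} (he : IsOpenEmbedding e)
    (φ : C(((range e)ᶜ : Set Y), Metric.sphere (0 : E) 1)) {W : Set Y} (hW : IsOpen W)
    (hsub : (range e)ᶜ ⊆ W) (ψ : C(W, Metric.sphere (0 : E) 1))
    (hψ : ∀ (z : Y) (hz : z ∈ (range e)ᶜ) (hzW : z ∈ W), ψ ⟨z, hzW⟩ = φ ⟨z, hz⟩)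
    {p : X → E} (hp : IsProperMap p)
    (hpψ : ∀ (x : X) (hx : e x ∈ W), p x = ‖p x‖ • (ψ ⟨e x, hx⟩ : E))
    (hp0 : ∀ x : X, e x ∉ W → p x = 0) (k : ℕ)
    (u : Cohomology (Metric.sphere (0 : E) 1) k) :
    ∃ w, cptPullback p hp (k + 1) w = coronaDelta he k (pullback φ k u) := by
  obtain ⟨⟨c, hc⟩, rfl⟩ := Submodule.Quotient.mk_surjective _ u
  obtain ⟨h, hδ⟩ := coronaDelta_pullback he φ hW hsub ψ hψ hc
  refine ⟨Submodule.Quotient.mk ⟨_, d_extend_radial_mem hc⟩, ?_⟩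
  rw [hδ]
  refine (Submodule.Quotient.eq _).2 ?_
  change pull p (d (extend {0}ᶜ (pull radial c))) - pull e (d (extend W (pull ψ c)))
    ∈ coboundaries (cptCochains X) (k + 1)
  rw [pull_d, pull_d, ← map_sub]
  -- The two primitives agree on tuples outside of the compact set `p ⁻¹' {0}`.
  refine Submodule.mem_sup_right ⟨_, ⟨p ⁻¹' {0}, hp.isCompact_preimage isCompact_singleton,
    fun y hy => ?_⟩, rfl⟩
  refine ⟨(p ⁻¹' {0})ᶜ,
    (isClosed_singleton.preimage hp.continuous).isOpen_compl.mem_nhds hy, fun t ht => ?_⟩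
  have ht0 : ∀ i, p (t i) ∈ ({0}ᶜ : Set E) := ht
  have htW : ∀ i, e (t i) ∈ W := fun i => not_not.1 fun hn => ht0 i (hp0 _ hn)
  simp only [Pi.sub_apply, pull, extend, LinearMap.coe_mk, AddHom.coe_mk, Function.comp_apply,
    ht0, htW, implies_true, dif_pos]
  rw [sub_eq_zero]
  congr 1
  funext i
  refine Subtype.ext ?_
  change ‖p (t i)‖⁻¹ • p (t i) = ψ ⟨e (t i), htW i⟩
  rw [inv_smul_eq_iff₀ (norm_ne_zero_iff.2 (ht0 i))]
  exact hpψ _ _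

end Radial

end AlexanderSpanier

/-! ### Displacement and variation at infinity -/

section Hurder

variable {Γ X : Type*} [Group Γ] [MulAction Γ X]

lemma wordLength_le_one {S : Finset Γ} {s : Γ} (hs : s ∈ S) : wordLength S s ≤ 1 :=
  Nat.sInf_le ⟨[s], by simpa using hs, by simp, rfl⟩

lemma DisplacementBound.of_generators {E : Type*} [NormedAddCommGroup E] {S : Finset Γ}
    (hS : IsSymmGenSet S) {p : X → E} (h : ∀ s ∈ S, ∀ x, ‖p x - p (s • x)‖ ≤ 1) :
    DisplacementBound S p := by
  have key : ∀ (l : List Γ), (∀ s ∈ l, s ∈ S) → ∀ x, ‖p x - p (l.prod • x)‖ ≤ l.length := by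
    intro l
    induction l with
    | nil => simp
    | cons s l ih =>
      intro hl x
      have h1 := ih (fun a ha => hl a (List.mem_cons_of_mem _ ha)) x
      have h2 := h s (hl s List.mem_cons_self) (l.prod • x)
      rw [List.prod_cons, mul_smul, List.length_cons, Nat.cast_succ]
      exact (norm_sub_le_norm_sub_add_norm_sub _ (p (l.prod • x)) _).trans (add_le_add h1 h2)
  intro γ x
  obtain ⟨l, hl, rfl, hlen⟩ := hS.exists_word γ
  exact hlen ▸ key l hl x

variable [TopologicalSpace X]

lemma tendsto_toHurder_smul {S : Finset Γ} {s : Γ} (hs : s ∈ S) :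
    Tendsto (fun x : X => (toHurder S X x, toHurder S X (s • x))) (cocompact X)
      (uniformity (HurderCompactification S X)) := by
  rw [uniformity_subtype, tendsto_comap_iff, Pi.uniformity, tendsto_iInf]
  intro f
  rw [tendsto_comap_iff, Metric.uniformity_eq_comap_nhds_zero, tendsto_comap_iff]
  refine squeeze_zero (fun _ => dist_nonneg) (fun x => ?_) (f.2 1)
  change dist (f.1 x) (f.1 (s • x)) ≤ _
  rw [Real.dist_eq]
  refine le_ciSup (f := fun γ : {γ : Γ // wordLength S γ ≤ 1} => |f.1 x - f.1 (γ.1 • x)|)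
    ⟨2 * ‖f.1‖, ?_⟩ ⟨s, wordLength_le_one hs⟩
  rintro _ ⟨γ, rfl⟩
  exact f.1.dist_le_two_norm _ _

/-- Continuous functions on the Hurder compactification vary slowly near infinity: they are
uniformly continuous, and the uniformity is induced by the functions of the Hurder algebra. -/
lemma tendsto_sum_norm_sub_smul {E : Type*} [NormedAddCommGroup E] (S : Finset Γ)
    {q : HurderCompactification S X → E} (hq : Continuous q) :
    Tendsto (fun x : X => ∑ s ∈ S, ‖q (toHurder S X x) - q (toHurder S X (s • x))‖)
      (cocompact X) (𝓝 0) := by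
  rw [← Finset.sum_const_zero (s := S)]
  refine tendsto_finsetSum S fun s hs => ?_
  have huc : Tendsto _ _ _ := CompactSpace.uniformContinuous_of_continuous hq
  have h := huc.comp (tendsto_toHurder_smul (X := X) hs)
  rw [Metric.uniformity_eq_comap_nhds_zero, tendsto_comap_iff] at h
  exact h.congr fun x => dist_eq_norm _ _

/-! ### Slowly growing proper functions -/

section Exhaustion

variable [LocallyCompactSpace X] [ContinuousConstSMul Γ X]

/-- Compact sets can be exhausted so fast that `S` moves each of them into the next one and given
eventual conditions hold outside of them. -/
lemma exists_fast_exhaustion [SigmaCompactSpace X] (S : Finset Γ) {P : ℕ → X → Prop}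
    (hP : ∀ i, ∀ᶠ x in cocompact X, P i x) :
    ∃ K : ℕ → Set X, (∀ i, IsCompact (K i)) ∧ (∀ i, K i ⊆ interior (K (i + 1))) ∧
      (⋃ i, K i) = univ ∧ (∀ i, ∀ s ∈ S, ∀ x ∈ K i, s • x ∈ K (i + 1)) ∧
      ∀ i, ∀ x ∉ K i, P i x := by
  have hL : ∀ i, ∃ L : Set X, IsCompact L ∧ ∀ x ∉ L, P i x := fun i => by
    obtain ⟨L, hL, hLP⟩ := mem_cocompact.1 (hP i)
    exact ⟨L, hL, fun x hx => hLP hx⟩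
  choose L hLc hLP using hL
  have hnext : ∀ (i : ℕ) (K : {K : Set X // IsCompact K}), ∃ K' : {K : Set X // IsCompact K},
      K.1 ∪ (⋃ s ∈ S, (fun x : X => s • x) '' K.1) ∪ (compactCovering X i ∪ L (i + 1))
        ⊆ interior K'.1 := by
    intro i K
    obtain ⟨K', hK', h⟩ := exists_compact_superset
      ((K.2.union (S.isCompact_biUnion fun s _ => K.2.image (continuous_const_smul s))).union
        ((isCompact_compactCovering X i).union (hLc (i + 1))))
    exact ⟨⟨K', hK'⟩, h⟩
  choose next hnext using hnext
  let K : ℕ → {K : Set X // IsCompact K} := fun i => Nat.rec ⟨L 0, hLc 0⟩ next i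
  have hK : ∀ i, (K i).1 ∪ (⋃ s ∈ S, (fun x : X => s • x) '' (K i).1)
      ∪ (compactCovering X i ∪ L (i + 1)) ⊆ interior (K (i + 1)).1 := fun i => hnext i (K i)
  refine ⟨fun i => (K i).1, fun i => (K i).2, fun i x hx => hK i (Or.inl (Or.inl hx)), ?_, ?_, ?_⟩
  · refine eq_univ_of_forall fun x => ?_
    obtain ⟨i, hi⟩ := exists_mem_compactCovering x
    exact mem_iUnion.2 ⟨i + 1, interior_subset (hK i (Or.inr (Or.inl hi)))⟩
  · intro i s hs x hx
    exact interior_subset (hK i (Or.inl (Or.inr (mem_biUnion hs ⟨x, hx, rfl⟩))))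
  · rintro (_ | i) x hx
    · exact hLP 0 x hx
    · exact hLP (i + 1) x fun h => hx (interior_subset (hK i (Or.inr (Or.inr h))))

/-- There is a proper function `r` that grows so slowly that it varies little under `S` and that
`r * g` stays small.  With `g` a bound for the variation of a bounded map `q` under `S`, this
bounds the displacement of `r • q`. -/
lemma exists_slow_proper [T2Space X] [SecondCountableTopology X] {S : Finset Γ} (hS : IsSymmGenSet S)
    {g : X → ℝ} (hg : Tendsto g (cocompact X) (𝓝 0)) {K₀ : Set X} (hK₀ : IsCompact K₀) :
    ∃ r : C(X, ℝ), Tendsto r (cocompact X) atTop ∧ (∀ x, 0 ≤ r x) ∧ (∀ x ∈ K₀, r x = 0) ∧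
      (∀ s ∈ S, ∀ x, |r x - r (s • x)| ≤ 1 / 2) ∧ ∀ x, r x * g x ≤ 1 / 2 := by
  obtain ⟨K, hKc, hKi, hKu, hKS, hKP⟩ := exists_fast_exhaustion (X := X) S
    (P := fun i x => x ∉ K₀ ∧ g x < 2 / ((i : ℝ) + 1)) fun i =>
      Filter.Eventually.and hK₀.compl_mem_cocompact (hg.eventually_lt_const (by positivity))
  have hmono : Monotone K := monotone_nat_of_le_succ fun i => (hKi i).trans interior_subset
  have hex : ∀ x, ∃ i, x ∈ K i := fun x => mem_iUnion.1 (hKu ▸ mem_univ x)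
  classical
  -- `r` is selected between `N - 1` and `N`, where `N x` is the first index with `x ∈ K (N x)`.
  -- The constant `N x` works near `x`, since nearby values of `N` are `N x` or `N x + 1`.  The
  -- subtraction is truncated, which makes `r` vanish on `K 0` and non-negative everywhere.
  let N : X → ℕ := fun x => Nat.find (hex x)
  have hN : ∀ x i, N x ≤ i ↔ x ∈ K i := fun x i =>
    ⟨fun h => hmono h (Nat.find_spec (hex x)), fun h => Nat.find_min' _ h⟩
  obtain ⟨r, hr⟩ := exists_continuous_forall_mem_convex_of_local_const
    (t := fun x => Icc (((N x - 1 : ℕ) : ℝ)) (N x : ℝ)) (fun x => convex_Icc _ _) (fun x => by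
      refine ⟨(N x : ℝ), ?_⟩
      have h1 : ∀ᶠ y in 𝓝 x, N x ≤ N y := by
        rcases Nat.eq_zero_or_pos (N x) with h0 | h0
        · exact Eventually.of_forall fun y => h0 ▸ Nat.zero_le _
        · have hx : x ∈ (K (N x - 1))ᶜ := fun h => by
            have := (hN x _).2 h
            omega
          filter_upwards [(hKc _).isClosed.isOpen_compl.mem_nhds hx] with y hy
          have : ¬ N y ≤ N x - 1 := fun h => hy ((hN y _).1 h)
          omega
      have h2 : ∀ᶠ y in 𝓝 x, N y ≤ N x + 1 := by
        filter_upwards [isOpen_interior.mem_nhds (hKi _ ((hN x _).1 le_rfl))] with y hy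
        exact (hN y _).2 (interior_subset hy)
      filter_upwards [h1, h2] with y hy1 hy2
      exact ⟨by exact_mod_cast Nat.sub_le_iff_le_add.2 hy2, by exact_mod_cast hy1⟩)
  have hlow : ∀ x, (N x : ℝ) - 1 ≤ r x := fun x =>
    (sub_le_iff_le_add.2 (by exact_mod_cast le_tsub_add)).trans (hr x).1
  have hnonneg : ∀ x, 0 ≤ r x := fun x => (Nat.cast_nonneg _).trans (hr x).1
  have hNS : ∀ s ∈ S, ∀ x, N (s • x) ≤ N x + 1 := fun s hs x =>
    (hN _ _).2 (hKS _ s hs x ((hN x _).1 le_rfl))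
  refine ⟨⟨fun x => r x / 4, by fun_prop⟩, ?_, fun x => div_nonneg (hnonneg x) (by norm_num),
    fun x hx => ?_, fun s hs x => ?_, fun x => ?_⟩
  · refine Tendsto.atTop_div_const (by norm_num) (tendsto_atTop.2 fun b => ?_)
    obtain ⟨i, hi⟩ := exists_nat_ge b
    filter_upwards [(hKc i).compl_mem_cocompact] with x hx
    have h : i + 1 ≤ N x := not_le.1 fun h => hx ((hN x i).1 h)
    have h' : (i : ℝ) + 1 ≤ N x := by exact_mod_cast h
    linarith [hlow x]
  · have h0 : N x = 0 := Nat.le_zero.1 ((hN x 0).2 (not_not.1 fun h => (hKP 0 x h).1 hx))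
    have h1 := (hr x).2
    rw [h0, Nat.cast_zero] at h1
    simp [le_antisymm h1 (hnonneg x)]
  · have h1 : (N (s • x) : ℝ) ≤ N x + 1 := by exact_mod_cast hNS s hs x
    have h2 : (N x : ℝ) ≤ N (s • x) + 1 := by
      have := hNS s⁻¹ (hS.inv_mem s hs) (s • x)
      rw [inv_smul_smul] at this
      exact_mod_cast this
    have h3 := hlow x
    have h4 := hlow (s • x)
    have h5 := (hr x).2
    have h6 := (hr (s • x)).2
    change |r x / 4 - r (s • x) / 4| ≤ 1 / 2
    rw [abs_le]
    constructor <;> linarith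
  · change r x / 4 * g x ≤ 1 / 2
    have hup := (hr x).2
    rcases h : N x with _ | i
    · rw [h, Nat.cast_zero] at hup
      simp [le_antisymm hup (hnonneg x)]
    · have hx : x ∉ K i := fun hx => by
        have := (hN x i).2 hx
        omega
      have hgx := (hKP i x hx).2
      rw [h, Nat.cast_succ] at hup
      have h1 : r x * g x ≤ r x * (2 / ((i : ℝ) + 1)) :=
        mul_le_mul_of_nonneg_left hgx.le (hnonneg x)
      have h2 : r x * (2 / ((i : ℝ) + 1)) ≤ ((i : ℝ) + 1) * (2 / ((i : ℝ) + 1)) :=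
        mul_le_mul_of_nonneg_right hup (by positivity)
      rw [mul_div_cancel₀ _ (by positivity)] at h2
      linarith

end Exhaustion

end Hurder

/-! ### Essential maps in polar coordinates -/

/-- `X` is a contractible topological manifold of dimension `n = m + 1 ≥ 1`, on which the group
`Γ` with finite symmetric generating set `S` acts by homeomorphisms.  Local compactness of `X`
follows from the existence of charts; it is listed for the instance search only.  The hypothesis
`hφ` says that `δ ∘ φ^*` is not zero on `H^(n-1)(S^(n-1); ℚ)`, i.e. `δ [φ] ≠ 0`. -/
theorem proposition5 {Γ X : Type*} [Group Γ] [TopologicalSpace X] [T2Space X]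
    [SecondCountableTopology X] [LocallyCompactSpace X] [ContractibleSpace X] (m : ℕ)
    [ChartedSpace (EuclideanSpace ℝ (Fin (m + 1))) X] [MulAction Γ X] [ContinuousConstSMul Γ X]
    (S : Finset Γ) (hS : IsSymmGenSet S)
    (φ : C(HurderCorona S X, Metric.sphere (0 : EuclideanSpace ℝ (Fin (m + 1))) 1))
    (hφ : ∃ u : AlexanderSpanier.Cohomology
        (Metric.sphere (0 : EuclideanSpace ℝ (Fin (m + 1))) 1) m,
      hurderDelta hS m (AlexanderSpanier.pullback φ m u) ≠ 0) :
    ∃ p : X → EuclideanSpace ℝ (Fin (m + 1)),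
      IsEssential (m + 1) p ∧ DisplacementBound S p ∧ IsPolarExtension S φ p := by
  obtain ⟨u, hu⟩ := hφ
  have hemb := isOpenEmbedding_toHurder (X := X) hS
  obtain ⟨F, hF⟩ := ContinuousMap.exists_restrict_eq hemb.isOpen_range.isClosed_compl
    ((⟨Subtype.val, continuous_subtype_val⟩ : C(Metric.sphere (0 : EuclideanSpace ℝ
      (Fin (m + 1))) 1, EuclideanSpace ℝ (Fin (m + 1)))).comp φ)
  have hFφ : ∀ z : HurderCorona S X, F z = φ z := fun z => DFunLike.congr_fun hF z
  let q : HurderCompactification S X → EuclideanSpace ℝ (Fin (m + 1)) := fun z =>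
    (max (1 / 2) ‖F z‖)⁻¹ • F z
  have hmax : ∀ z, (0 : ℝ) < max (1 / 2) ‖F z‖ := fun z => lt_max_of_lt_left (by norm_num)
  have hqc : Continuous q :=
    ((continuous_const.max F.continuous.norm).inv₀ fun z => (hmax z).ne').smul F.continuous
  have hq1 : ∀ z, ‖q z‖ ≤ 1 := fun z => by
    rw [norm_smul, norm_inv, Real.norm_of_nonneg (hmax z).le, inv_mul_le_one₀ (hmax z)]
    exact le_max_right _ _
  let W : Set (HurderCompactification S X) := {z | 1 / 2 < ‖F z‖}
  have hWo : IsOpen W := isOpen_lt continuous_const F.continuous.norm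
  have hqW : ∀ z ∈ W, ‖q z‖ = 1 := fun z hz => by
    have hz' : (1 / 2 : ℝ) < ‖F z‖ := hz
    rw [norm_smul, norm_inv, Real.norm_of_nonneg (hmax z).le, max_eq_right hz'.le,
      inv_mul_cancel₀ (by linarith)]
  have hFcor : ∀ z : HurderCorona S X, ‖F z‖ = 1 := fun z => by
    rw [hFφ]
    exact mem_sphere_zero_iff_norm.1 (φ z).2
  have hWsub : HurderCorona S X ⊆ W := fun z hz => by
    change 1 / 2 < ‖F z‖
    rw [hFcor ⟨z, hz⟩]
    norm_num
  have hqφ : ∀ z : HurderCorona S X, q z = φ z := fun z => by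
    change (max (1 / 2) ‖F z‖)⁻¹ • F z = φ z
    rw [hFcor z, hFφ z]
    norm_num
  let ψ : C(W, Metric.sphere (0 : EuclideanSpace ℝ (Fin (m + 1))) 1) :=
    ⟨fun z => ⟨q z, mem_sphere_zero_iff_norm.2 (hqW z z.2)⟩,
      (hqc.comp continuous_subtype_val).subtype_mk _⟩
  have hψ : ∀ (z : HurderCompactification S X) (hz : z ∈ HurderCorona S X) (hW : z ∈ W),
      ψ ⟨z, hW⟩ = φ ⟨z, hz⟩ := fun z hz hW => Subtype.ext (hqφ ⟨z, hz⟩)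
  have hK₀ : IsCompact (toHurder S X ⁻¹' Wᶜ) :=
    hemb.isInducing.isCompact_preimage' hWo.isClosed_compl.isCompact fun z hz =>
      not_not.1 fun h => hz (hWsub h)
  obtain ⟨r, hrtop, hr0, hrK, hrS, hrg⟩ :=
    exists_slow_proper hS (tendsto_sum_norm_sub_smul S hqc) hK₀
  let p : X → EuclideanSpace ℝ (Fin (m + 1)) := fun x => r x • q (toHurder S X x)
  have hp0 : ∀ x, toHurder S X x ∉ W → p x = 0 := fun x hx => by
    change r x • q (toHurder S X x) = 0
    rw [hrK x hx, zero_smul]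
  have hpr : ∀ x, ‖p x‖ = r x := fun x => by
    by_cases hx : toHurder S X x ∈ W
    · rw [norm_smul, hqW _ hx, mul_one, Real.norm_of_nonneg (hr0 x)]
    · rw [hp0 x hx, norm_zero, hrK x hx]
  have hpψ : ∀ (x : X) (hx : toHurder S X x ∈ W),
      p x = ‖p x‖ • (ψ ⟨toHurder S X x, hx⟩ : EuclideanSpace ℝ (Fin (m + 1))) := fun x hx => by
    rw [hpr]
    rfl
  have hproper : IsProperMap p := by
    refine isProperMap_iff_tendsto_cocompact.2
      ⟨r.continuous.smul (hqc.comp (continuous_toHurder S)), ?_⟩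
    rw [← Metric.cobounded_eq_cocompact, ← tendsto_norm_atTop_iff_cobounded]
    exact hrtop.congr fun x => (hpr x).symm
  refine ⟨p, ⟨hproper, fun h => hu ?_⟩, DisplacementBound.of_generators hS fun s hs x => ?_,
    W, ψ, hWo, hWsub, hψ, hpψ, hp0⟩
  · obtain ⟨w, hw⟩ := AlexanderSpanier.exists_cptPullback_eq_coronaDelta hemb φ hWo hWsub ψ hψ
      hproper hpψ hp0 m u
    refine hw.symm.trans ?_
    rw [h]
    rfl
  · have hsplit : p x - p (s • x)
        = r x • (q (toHurder S X x) - q (toHurder S X (s • x)))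
          + (r x - r (s • x)) • q (toHurder S X (s • x)) := by
      change r x • q (toHurder S X x) - r (s • x) • q (toHurder S X (s • x)) = _
      module
    have h1 : ‖r x • (q (toHurder S X x) - q (toHurder S X (s • x)))‖ ≤ 1 / 2 := by
      rw [norm_smul, Real.norm_of_nonneg (hr0 x)]
      exact (mul_le_mul_of_nonneg_left (Finset.single_le_sum
        (f := fun s => ‖q (toHurder S X x) - q (toHurder S X (s • x))‖)
        (fun _ _ => norm_nonneg _) hs) (hr0 x)).trans (hrg x)
    have h2 : ‖(r x - r (s • x)) • q (toHurder S X (s • x))‖ ≤ 1 / 2 := by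
      rw [norm_smul, Real.norm_eq_abs]
      exact (mul_le_of_le_one_right (abs_nonneg _) (hq1 _)).trans (hrS s hs x)
    rw [hsplit]
    exact (norm_add_le _ _).trans (by linarith)
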